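/- Let $\mathcal D$ be the set of dyadic subintervals $[k2^{-n},(k+1)2^{-n})$, $n\ge 0$, $0\le k<2^n$, of $[0,1)$, and for $J\in\mathcal D$ write $|J|$ for its length, $\mathcal D(J)=\{K\in\mathcal D: K\subseteq J\}$ and $\langle f\rangle_J=\frac1{|J|}\int_J f$. The Carleson constant of a sequence $\alpha=\{\alpha_J\}_{J\in\mathcal D}$ of nonnegative real numbers is $\sup_{J\in\mathcal D}\frac1{|J|}\sum_{K\in\mathcal D(J)}\alpha_K|K|$. For nonnegative $f\in L^1([0,1))$ put $$\mathcal A_\alpha f(x)=\sum_{J\in\mathcal D}\alpha_J\langle f\rangle_J\mathbf 1_J(x)\in[0,\infty],\qquad x\in[0,1),$$ and let $\|g\|_{L^{1,\infty}}=\sup_{\lambda>0}\lambda\,|\{x\in[0,1): |g(x)|>\lambda\}|$. For $t\ge 0$ and $\lambda>0$ let $$b(t,\lambda)=\frac{2t}{\lambda+t}\ \text{ if } t\le\lambda,\qquad b(t,\lambda)=1\ \text{ if } t>\lambda .$$ (1) For every nonnegative $f\in L^1([0,1))$, every $\alpha$ with Carleson constant at most $1$ and every $\lambda>0$, $$|\{x\in[0,1):\mathcal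 A_\alpha f(x)>\lambda\}|\le b(\|f\|_{L^1},\lambda).$$ (2) This bound is sharp: for every $t\ge0$ and $\lambda>0$, $b(t,\lambda)$ is the supremum of $|\{x\in[0,1):\mathcal A_\alpha f(x)>\lambda\}|$ over all nonnegative $f\in L^1([0,1))$ with $\|f\|_{L^1}=t$ and all $\alpha$ with Carleson constant at most $1$. (3) For every nonnegative $f\in L^1([0,1))$ and every $\alpha$ with Carleson constant at most $1$, $\|\mathcal A_\alpha f\|_{L^{1,\infty}}\le 2\|f\|_{L^1}$. (4) The constant $2$ is sharp: if $C$ is such that $\|\mathcal A_\alpha f\|_{L^{1,\infty}}\le C\|f\|_{L^1}$ for all such $f$ and $\alpha$, then $C\ge 2$. -/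

import Mathlib

open MeasureTheory Set
open scoped NNReal ENNReal

noncomputable section

namespace DyadicShift

/-- Indices of the dyadic subintervals of `[0,1)`: the pair `(n, k)` with `k < 2 ^ n` stands for
`[k / 2 ^ n, (k + 1) / 2 ^ n)`. -/
abbrev Dyadic : Type := Σ n : ℕ, Fin (2 ^ n)

/-- The dyadic interval `[k / 2 ^ n, (k + 1) / 2 ^ n)`. -/
def Dyadic.interval (J : Dyadic) : Set ℝ :=
  Ico ((J.2 : ℝ) / 2 ^ J.1) (((J.2 : ℝ) + 1) / 2 ^ J.1)

/-- The Carleson constant `sup_J |J|⁻¹ ∑_{K ∈ D(J)} α_K |K|` of a nonnegative sequence indexed by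
the dyadic subintervals of `[0,1)`. -/
def carlesonConst (α : Dyadic → ℝ≥0) : ℝ≥0∞ :=
  ⨆ J : Dyadic,
    (∑' K : {K : Dyadic // K.interval ⊆ J.interval}, (α K : ℝ≥0∞) * volume K.1.interval) /
      volume J.interval

/-- The operator `𝒜 f (x) = ∑_J α_J ⟨f⟩_J 1_J(x)`, for `f` nonnegative (almost everywhere) and
integrable on `[0,1)`. The series has nonnegative terms and is summed in `[0, ∞]`. -/
def lernerOp (α : Dyadic → ℝ≥0) (f : ℝ → ℝ) (x : ℝ) : ℝ≥0∞ :=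
  ∑' J : Dyadic,
    J.interval.indicator (fun _ => (α J : ℝ≥0∞) * ENNReal.ofReal (⨍ y in J.interval, f y)) x

/-- `f` is a nonnegative element of `L¹([0,1))`. -/
def NonnegL1 (f : ℝ → ℝ) : Prop :=
  IntegrableOn f (Ico 0 1) ∧ ∀ᵐ x ∂volume.restrict (Ico (0 : ℝ) 1), 0 ≤ f x

/-- The norm of `L¹([0,1))`. -/
def normL1 (f : ℝ → ℝ) : ℝ := ∫ x in Ico (0 : ℝ) 1, |f x|

/-- The measure of the superlevel set `{x ∈ [0,1) : g x > lam}`. -/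
def distrib (g : ℝ → ℝ≥0∞) (lam : ℝ) : ℝ≥0∞ :=
  volume {x : ℝ | x ∈ Ico (0 : ℝ) 1 ∧ ENNReal.ofReal lam < g x}

/-- The quasinorm of `L^{1,∞}([0,1))`: `sup_{lam > 0} lam |{x ∈ [0,1) : g x > lam}|`. -/
def weakL1 (g : ℝ → ℝ≥0∞) : ℝ≥0∞ :=
  ⨆ (lam : ℝ) (_ : 0 < lam), ENNReal.ofReal lam * distrib g lam

/-- The bound, as a function of `t = ‖f‖₁` and the level `lam`. -/
def levelBound (t lam : ℝ) : ℝ := if t ≤ lam then 2 * t / (lam + t) else 1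

end DyadicShift

end

/-!
Localize the problem to a dyadic interval `J` and record only the average `x` of `f` over `J` and
the Carleson density `A` of `α` on `J`. By homogeneity the level may be taken to be one, and the
largest fraction of `J` that the superlevel set can fill is then bounded by `bellman x A`. Passing
from the children of `J` to `J` averages `(x, A)`, raises `A` by the coefficient `a` of `J` and the
level by `a * x`; correspondingly `bellman` is concave, and it increases along the curves
`1 / x - A = const` which this raise follows. Induction from the leaves to the root proves the
bound when `α` is finitely supported, and monotone convergence removes this restriction. At the
root the density is at most one and `bellman (t / lam) 1` is the asserted bound.

For sharpness, start from a constant function slightly above the level, with density one.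
Concentrating the configuration on the proportion `r = 1 - 2 ^ (-m)` of an interval multiplies the
average, the density and the measure of the superlevel set by `r`, and the density `1 - r` thus
freed is spent on raising the level at the larger interval. Iterating and letting `m → ∞` exhausts
the bound.
-/

noncomputable section

namespace DyadicShift

/-! ### The Bellman function -/

/-- The harmonic mean of `x` and `A` for `x ≤ A`, the geometric mean for `A ≤ x`. This is the
Bellman function before truncation at height one. -/
def mixedMean (x A : ℝ) : ℝ := if x ≤ A then 2 * x * A / (x + A) else √(x * A)

/-- The Bellman function of the superlevel sets at level one: `x` stands for the average of the
function and `A` for the Carleson mass of the sequence, both normalized by the length of the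
interval. -/
def bellman (x A : ℝ) : ℝ := min (mixedMean x A) 1

lemma mixedMean_of_le {x A : ℝ} (h : x ≤ A) : mixedMean x A = 2 * x * A / (x + A) := if_pos h

lemma mixedMean_eq_two_div {x A : ℝ} (hx : 0 < x) (h : x ≤ A) :
    mixedMean x A = 2 / (x⁻¹ + A⁻¹) := by
  have hA := hx.trans_le h
  rw [mixedMean_of_le h]
  field_simp
  ring

lemma mixedMean_of_ge {x A : ℝ} (hA : 0 ≤ A) (h : A ≤ x) : mixedMean x A = √(x * A) := by
  rcases h.eq_or_lt with rfl | h
  · rw [mixedMean_of_le le_rfl, Real.sqrt_mul_self hA, mul_assoc, ← two_mul,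
      mul_div_mul_left _ _ two_ne_zero, mul_self_div_self]
  · exact if_neg h.not_ge

lemma mixedMean_nonneg {x A : ℝ} (hx : 0 ≤ x) (hA : 0 ≤ A) : 0 ≤ mixedMean x A := by
  unfold mixedMean
  split_ifs <;> positivity

lemma mixedMean_le_sqrt {x A : ℝ} (hx : 0 ≤ x) (hA : 0 ≤ A) : mixedMean x A ≤ √(x * A) := by
  rcases le_total x A with h | h
  · rw [mixedMean_of_le h]
    refine Real.le_sqrt_of_sq_le ?_
    rcases (add_nonneg hx hA).eq_or_lt with h0 | hpos
    · simp [← h0, mul_nonneg hx hA]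
    · rw [div_pow, div_le_iff₀ (by positivity)]
      nlinarith [mul_nonneg (mul_nonneg hx hA) (sq_nonneg (x - A))]
  · exact (mixedMean_of_ge hA h).le

lemma mixedMean_zero_right {x : ℝ} (hx : 0 ≤ x) : mixedMean x 0 = 0 := by
  rw [mixedMean_of_ge le_rfl hx, mul_zero, Real.sqrt_zero]

lemma mixedMean_le_of_four_mul_eq_one {p q x A : ℝ} (hp : 0 ≤ p) (hq : 0 ≤ q)
    (hpq : 4 * (p * q) = 1) (hx : 0 ≤ x) (hA : 0 ≤ A) : mixedMean x A ≤ p * x + q * A := by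
  refine (mixedMean_le_sqrt hx hA).trans (Real.sqrt_le_iff.2 ⟨by positivity, ?_⟩)
  calc x * A = 4 * (p * x) * (q * A) := by linear_combination -(x * A) * hpq
    _ ≤ (p * x + q * A) ^ 2 := four_mul_le_pow_two_add _ _

lemma mixedMean_le_of_half_le {θ x A : ℝ} (hθ : 1 / 2 ≤ θ) (hx : 0 ≤ x) (hA : 0 ≤ A) :
    mixedMean x A ≤ 2 * θ ^ 2 * x + 2 * (1 - θ) ^ 2 * A := by
  rcases le_total x A with h | h
  · rw [mixedMean_of_le h]
    rcases (add_nonneg hx hA).eq_or_lt with h0 | hpos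
    · rw [← h0, div_zero]
      positivity
    · rw [div_le_iff₀ hpos]
      nlinarith [sq_nonneg (θ * x - (1 - θ) * A)]
  · have hgap : 0 ≤ (θ - 1 / 2) * (θ + 1 / 2) * (x - A) :=
      mul_nonneg (mul_nonneg (by linarith) (by linarith)) (by linarith)
    calc mixedMean x A ≤ 1 / 2 * x + 1 / 2 * A :=
          mixedMean_le_of_four_mul_eq_one (by norm_num) (by norm_num) (by norm_num) hx hA
      _ ≤ 2 * θ ^ 2 * x + 2 * (1 - θ) ^ 2 * A := by
          nlinarith [mul_nonneg (sq_nonneg (θ - 1 / 2)) hA]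

lemma exists_linear_support_mixedMean {x A : ℝ} (hx : 0 ≤ x) (hA : 0 < A) :
    ∃ p q : ℝ, 0 ≤ q ∧ mixedMean x A = p * x + q * A ∧
      ∀ y B : ℝ, 0 ≤ y → 0 ≤ B → mixedMean y B ≤ p * y + q * B := by
  rcases le_total x A with h | h
  · have hpos : 0 < x + A := by linarith
    refine ⟨2 * (A / (x + A)) ^ 2, 2 * (1 - A / (x + A)) ^ 2, by positivity, ?_,
      fun y B hy hB => mixedMean_le_of_half_le ?_ hy hB⟩
    · rw [mixedMean_of_le h]
      field_simp
      ring
    · rw [le_div_iff₀ hpos]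
      linarith
  · have hx' : 0 < x := hA.trans_le h
    have hsx := Real.sq_sqrt hx
    have hsA := Real.sq_sqrt hA.le
    refine ⟨√A / √x / 2, √x / √A / 2, by positivity, ?_,
      fun y B hy hB => mixedMean_le_of_four_mul_eq_one (by positivity) (by positivity) ?_ hy hB⟩
    · rw [mixedMean_of_ge hA.le h, Real.sqrt_mul hx]
      field_simp
      rw [hsx, hsA]
      ring
    · field_simp
      norm_num

lemma concaveOn_mixedMean :
    ConcaveOn ℝ (Ici (0 : ℝ) ×ˢ Ici (0 : ℝ)) fun p => mixedMean p.1 p.2 := by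
  refine ⟨(convex_Ici 0).prod (convex_Ici 0), ?_⟩
  rintro ⟨x, A⟩ ⟨hx, hA⟩ ⟨y, B⟩ ⟨hy, hB⟩ a b ha hb -
  simp only [mem_Ici] at hx hA hy hB
  simp only [Prod.smul_mk, Prod.mk_add_mk, smul_eq_mul]
  rcases (by positivity : 0 ≤ a * A + b * B).eq_or_lt with h0 | hpos
  · have haA : a * mixedMean x A = 0 := by
      rcases mul_eq_zero.1 (by nlinarith [mul_nonneg ha hA, mul_nonneg hb hB] : a * A = 0)
        with rfl | rfl <;> simp [mixedMean_zero_right, hx]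
    have hbB : b * mixedMean y B = 0 := by
      rcases mul_eq_zero.1 (by nlinarith [mul_nonneg ha hA, mul_nonneg hb hB] : b * B = 0)
        with rfl | rfl <;> simp [mixedMean_zero_right, hy]
    rw [haA, hbB, add_zero]
    exact mixedMean_nonneg (by positivity) (by positivity)
  · obtain ⟨p, q, -, heq, hle⟩ :=
      exists_linear_support_mixedMean (by positivity : 0 ≤ a * x + b * y) hpos
    rw [heq]
    linarith [mul_le_mul_of_nonneg_left (hle x A hx hA) ha,
      mul_le_mul_of_nonneg_left (hle y B hy hB) hb]

lemma mixedMean_mono_right {x A B : ℝ} (hx : 0 ≤ x) (hA : 0 ≤ A) (hAB : A ≤ B) :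
    mixedMean x A ≤ mixedMean x B := by
  rcases (hA.trans hAB).eq_or_lt with rfl | hB
  · rw [le_antisymm hAB hA]
  obtain ⟨p, q, hq, heq, hle⟩ := exists_linear_support_mixedMean hx hB
  calc mixedMean x A ≤ p * x + q * A := hle x A hx hA
    _ ≤ p * x + q * B := by gcongr
    _ = mixedMean x B := heq.symm

lemma bellman_nonneg {x A : ℝ} (hx : 0 ≤ x) (hA : 0 ≤ A) : 0 ≤ bellman x A :=
  le_min (mixedMean_nonneg hx hA) zero_le_one

lemma bellman_le_one (x A : ℝ) : bellman x A ≤ 1 := min_le_right _ _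

lemma bellman_mono_right {x A B : ℝ} (hx : 0 ≤ x) (hA : 0 ≤ A) (hAB : A ≤ B) :
    bellman x A ≤ bellman x B :=
  min_le_min_right _ (mixedMean_mono_right hx hA hAB)

lemma concaveOn_bellman :
    ConcaveOn ℝ (Ici (0 : ℝ) ×ˢ Ici (0 : ℝ)) fun p => bellman p.1 p.2 :=
  concaveOn_mixedMean.inf (concaveOn_const 1 concaveOn_mixedMean.1)

lemma bellman_eq_one {x A : ℝ} (hx : 0 ≤ x) (hA : A ≤ 1) (h : 1 ≤ x * A) : bellman x A = 1 := by
  have hx1 : 1 ≤ x := h.trans (mul_le_of_le_one_right hx hA)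
  have hA0 : 0 ≤ A := by nlinarith
  rw [bellman, mixedMean_of_ge hA0 (hA.trans hx1)]
  exact min_eq_right (Real.one_le_sqrt.2 h)

lemma bellman_div_one {t lam : ℝ} (ht : 0 ≤ t) (hlam : 0 < lam) :
    bellman (t / lam) 1 = levelBound t lam := by
  unfold levelBound
  split_ifs with h
  · have hmean : mixedMean (t / lam) 1 = 2 * t / (lam + t) := by
      rw [mixedMean_of_le ((div_le_one hlam).2 h)]
      field_simp
      ring
    rw [bellman, hmean, min_eq_left]
    rw [div_le_one (by linarith)]
    linarith
  · refine bellman_eq_one (by positivity) le_rfl ?_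
    rw [mul_one, one_le_div hlam]
    linarith

/-! ### Monotonicity along the characteristic curves -/

section Characteristic

variable {x y A B : ℝ}

lemma mixedMean_le_of_inv_sub_eq (hx : 0 < x) (hy : 0 < y) (hxA : x ≤ A) (hAB : A ≤ B)
    (hB : B ≤ 1) (h : x⁻¹ - A = y⁻¹ - B) : mixedMean x A ≤ mixedMean y B := by
  have hA : 0 < A := hx.trans_le hxA
  have hB0 : 0 < B := hA.trans_le hAB
  have hyx : y ≤ x := (inv_le_inv₀ hx hy).1 (by linarith)
  have hinv : B - A ≤ A⁻¹ - B⁻¹ := by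
    rw [inv_sub_inv hA.ne' hB0.ne', le_div_iff₀ (by positivity)]
    exact mul_le_of_le_one_right (by linarith) (mul_le_one₀ (hAB.trans hB) hB0.le hB)
  rw [mixedMean_eq_two_div hx hxA, mixedMean_eq_two_div hy (hyx.trans (hxA.trans hAB))]
  gcongr 2 / ?_
  linarith

lemma bellman_le_of_inv_sub_eq_of_le (hx : 0 < x) (hA : 0 ≤ A) (hAB : A ≤ B) (hB : B ≤ 1)
    (hBy : B ≤ y) (hy : 0 < y) (h : x⁻¹ - A = y⁻¹ - B) : bellman x A ≤ bellman y B := by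
  rcases le_or_gt 1 (y * B) with hyB | hyB
  · rw [bellman_eq_one hy.le hB hyB]
    exact bellman_le_one x A
  refine min_le_min_right _ ((mixedMean_le_sqrt hx.le hA).trans ?_)
  rw [mixedMean_of_ge (hA.trans hAB) hBy]
  refine Real.sqrt_le_sqrt ?_
  have hBy' : B ≤ y⁻¹ := by
    rw [← one_div, le_div_iff₀ hy]
    linarith
  have hprod : A * y⁻¹ ≤ B * x⁻¹ := by
    nlinarith [mul_nonneg (sub_nonneg.2 hAB) (sub_nonneg.2 hBy')]
  rwa [← div_eq_mul_inv, ← div_eq_mul_inv, div_le_div_iff₀ hy hx, mul_comm A, mul_comm B] at hprod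

/-- Infinitesimally, `∂_A bellman ≥ x ^ 2 * ∂_x bellman` wherever `A ≤ 1`. -/
lemma bellman_le_of_inv_sub_eq (hx : 0 < x) (hy : 0 < y) (hA : 0 ≤ A) (hAB : A ≤ B) (hB : B ≤ 1)
    (h : x⁻¹ - A = y⁻¹ - B) : bellman x A ≤ bellman y B := by
  rcases le_or_gt x A with hxA | hxA
  · exact min_le_min_right _ (mixedMean_le_of_inv_sub_eq hx hy hxA hAB hB h)
  rcases le_or_gt B y with hBy | hBy
  · exact bellman_le_of_inv_sub_eq_of_le hx hA hAB hB hBy hy h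
  rcases hA.eq_or_lt with rfl | hA
  · rw [bellman, mixedMean_zero_right hx.le, min_eq_left zero_le_one]
    exact bellman_nonneg hy.le hAB
  -- the curve crosses the diagonal, where the formula for `mixedMean` changes
  obtain ⟨z, ⟨hAz, hzB⟩, hz⟩ : x⁻¹ - A ∈ (fun z : ℝ => z⁻¹ - z) '' Icc A B := by
    refine intermediate_value_Icc' hAB ?_ ⟨?_, ?_⟩
    · exact (continuousOn_id.inv₀ fun z hz => (hA.trans_le hz.1).ne').sub continuousOn_id
    · rw [h]
      gcongr
    · gcongr
  have hz0 : 0 < z := hA.trans_le hAz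
  calc bellman x A ≤ bellman z z :=
        bellman_le_of_inv_sub_eq_of_le hx hA.le hAz (hzB.trans hB) le_rfl hz0 hz.symm
    _ ≤ bellman y B :=
        min_le_min_right _ (mixedMean_le_of_inv_sub_eq hz0 hy le_rfl hzB hB (hz.trans h))

lemma bellman_div_sub_le {F a lam : ℝ} (hF : 0 ≤ F) (hA : 0 ≤ A) (ha : 0 ≤ a) (hAa : A + a ≤ 1)
    (hlam : a * F < lam) : bellman (F / (lam - a * F)) A ≤ bellman (F / lam) (A + a) := by
  rcases hF.eq_or_lt with rfl | hF
  · simpa using bellman_mono_right le_rfl hA (by linarith)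
  have hlam0 : 0 < lam := (mul_nonneg ha hF.le).trans_lt hlam
  refine bellman_le_of_inv_sub_eq (div_pos hF (sub_pos.2 hlam)) (div_pos hF hlam0) hA
    (by linarith) hAa ?_
  rw [inv_div, inv_div]
  field_simp
  ring

end Characteristic

/-- The main inequality of the Bellman function method: `w i` are the relative lengths of the
pieces of an interval, and `a` is the coefficient of the interval itself. -/
lemma sum_bellman_div_sub_le {ι : Type*} {s : Finset ι} {w F A : ι → ℝ} {a lam : ℝ}
    (hw : ∀ i ∈ s, 0 ≤ w i) (hw1 : ∑ i ∈ s, w i = 1) (hF : ∀ i ∈ s, 0 ≤ F i)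
    (hA : ∀ i ∈ s, 0 ≤ A i) (ha : 0 ≤ a) (hAa : ∑ i ∈ s, w i * A i + a ≤ 1)
    (hlam : a * ∑ i ∈ s, w i * F i < lam) :
    ∑ i ∈ s, w i * bellman (F i / (lam - a * ∑ j ∈ s, w j * F j)) (A i) ≤
      bellman ((∑ i ∈ s, w i * F i) / lam) (∑ i ∈ s, w i * A i + a) := by
  have hF' : 0 ≤ ∑ i ∈ s, w i * F i := Finset.sum_nonneg fun i hi => mul_nonneg (hw i hi) (hF i hi)
  have hA' : 0 ≤ ∑ i ∈ s, w i * A i := Finset.sum_nonneg fun i hi => mul_nonneg (hw i hi) (hA i hi)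
  set μ := lam - a * ∑ j ∈ s, w j * F j
  have hμ0 : 0 < μ := sub_pos.2 hlam
  have jensen := concaveOn_bellman.le_map_sum (p := fun i => (F i / μ, A i)) hw hw1
    fun i hi => ⟨div_nonneg (hF i hi) hμ0.le, hA i hi⟩
  simp only [smul_eq_mul, Prod.smul_mk, Prod.fst_sum, Prod.snd_sum, ← mul_div_assoc,
    ← Finset.sum_div] at jensen
  exact jensen.trans (bellman_div_sub_le hF' hA' ha hAa hlam)

/-! ### The dyadic tree -/

/-- The two halves of a dyadic interval: the left one for `i = 0`, the right one for `i = 1`. -/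
def Dyadic.child (J : Dyadic) (i : Fin 2) : Dyadic :=
  ⟨J.1 + 1, ⟨2 * J.2 + i, by have := J.2.2; rw [pow_succ]; omega⟩⟩

/-- The interval `[0,1)`, the root of the dyadic tree. -/
def Dyadic.root : Dyadic := ⟨0, 0⟩

/-- The family `D(J)` of the dyadic intervals contained in `J`. -/
def Dyadic.descendants (J : Dyadic) : Set Dyadic := {K | K.interval ⊆ J.interval}

namespace Dyadic

variable {J K : Dyadic}

lemma mem_descendants_self (J : Dyadic) : J ∈ J.descendants := Subset.rfl

lemma descendants_subset (h : K ∈ J.descendants) : K.descendants ⊆ J.descendants :=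
  fun _ hL => Subset.trans hL h

lemma measurableSet_interval (J : Dyadic) : MeasurableSet J.interval := measurableSet_Ico

lemma interval_root : root.interval = Ico 0 1 := by simp [interval, root]

lemma left_endpoint_lt (J : Dyadic) : (J.2 : ℝ) / 2 ^ J.1 < ((J.2 : ℝ) + 1) / 2 ^ J.1 := by
  gcongr
  exact lt_add_one _

lemma level_le_of_mem_descendants (h : K ∈ J.descendants) : J.1 ≤ K.1 := by
  obtain ⟨hleft, hright⟩ := (Ico_subset_Ico_iff K.left_endpoint_lt).1 h
  rw [add_div, add_div] at hright
  have hlen : (1 : ℝ) / 2 ^ K.1 ≤ 1 / 2 ^ J.1 := by linarith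
  rwa [one_div_le_one_div (by positivity) (by positivity),
    pow_le_pow_iff_right₀ one_lt_two] at hlen

lemma mem_descendants_iff {d : ℕ} (hd : K.1 = J.1 + d) :
    K ∈ J.descendants ↔ (J.2 : ℕ) * 2 ^ d ≤ K.2 ∧ (K.2 : ℕ) + 1 ≤ (J.2 + 1) * 2 ^ d := by
  have hscale (a : ℝ) : a / 2 ^ J.1 = a * 2 ^ d / 2 ^ K.1 := by
    rw [hd, pow_add, mul_div_mul_right _ _ (by positivity)]
  change Ico _ _ ⊆ Ico _ _ ↔ _
  rw [Ico_subset_Ico_iff K.left_endpoint_lt, hscale, hscale,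
    div_le_div_iff_of_pos_right (by positivity), div_le_div_iff_of_pos_right (by positivity)]
  norm_cast

lemma mem_descendants_root (J : Dyadic) : J ∈ root.descendants := by
  rw [mem_descendants_iff (zero_add J.1).symm]
  simp [root]

lemma child_mem_descendants (J : Dyadic) (i : Fin 2) : J.child i ∈ J.descendants := by
  rw [mem_descendants_iff rfl]
  dsimp only [child]
  omega

lemma notMem_descendants_child (J : Dyadic) (i : Fin 2) : J ∉ (J.child i).descendants :=
  fun h => (level_le_of_mem_descendants h).not_gt J.1.lt_succ_self

lemma eq_or_exists_mem_descendants_child (h : K ∈ J.descendants) :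
    K = J ∨ ∃ i, K ∈ (J.child i).descendants := by
  obtain ⟨d, hd⟩ := Nat.exists_eq_add_of_le (level_le_of_mem_descendants h)
  rw [mem_descendants_iff hd] at h
  rcases d with _ | d
  · left
    obtain ⟨n, j⟩ := J
    obtain ⟨n', k⟩ := K
    obtain rfl : n' = n := hd
    simp only [pow_zero, mul_one] at h
    rw [show k = j from Fin.ext (by omega)]
  · right
    have hchild (i : Fin 2) : K ∈ (J.child i).descendants ↔
        (2 * (J.2 : ℕ) + i) * 2 ^ d ≤ K.2 ∧ (K.2 : ℕ) + 1 ≤ (2 * J.2 + i + 1) * 2 ^ d :=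
      mem_descendants_iff (by rw [hd, child]; ring)
    simp only [hchild, Fin.exists_fin_two, Fin.val_zero, Fin.val_one]
    rw [pow_succ'] at h
    grind

lemma interval_child_zero (J : Dyadic) :
    (J.child 0).interval = Ico ((J.2 : ℝ) / 2 ^ J.1) (((J.2 : ℝ) + 1 / 2) / 2 ^ J.1) := by
  simp only [interval, child, pow_succ, Fin.val_zero]
  push_cast
  congr 1 <;> field_simp <;> ring

lemma interval_child_one (J : Dyadic) :
    (J.child 1).interval = Ico (((J.2 : ℝ) + 1 / 2) / 2 ^ J.1) (((J.2 : ℝ) + 1) / 2 ^ J.1) := by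
  simp only [interval, child, pow_succ, Fin.val_one]
  push_cast
  congr 1 <;> field_simp; ring

lemma iUnion_interval_child (J : Dyadic) : ⋃ i, (J.child i).interval = J.interval := by
  have hunion : ⋃ i, (J.child i).interval = (J.child 0).interval ∪ (J.child 1).interval := by
    ext
    simp only [mem_iUnion, Fin.exists_fin_two, mem_union]
  rw [hunion, interval_child_zero, interval_child_one, interval]
  refine Ico_union_Ico_eq_Ico ?_ ?_ <;> gcongr <;> linarith

lemma disjoint_interval_child (J : Dyadic) :
    Disjoint (J.child 0).interval (J.child 1).interval := by
  rw [interval_child_zero, interval_child_one]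
  exact Ico_disjoint_Ico_same

lemma pairwise_disjoint_interval_child (J : Dyadic) :
    Pairwise (Function.onFun Disjoint fun i => (J.child i).interval) := by
  refine (pairwise_disjoint_on _).2 fun i j hij => ?_
  obtain ⟨rfl, rfl⟩ : i = 0 ∧ j = 1 := by omega
  exact J.disjoint_interval_child

lemma pairwise_disjoint_descendants_child (J : Dyadic) :
    Pairwise (Function.onFun Disjoint fun i => (J.child i).descendants) := by
  refine fun i j hij => Set.disjoint_left.2 fun K hKi hKj => ?_
  obtain ⟨x, hx⟩ : K.interval.Nonempty := nonempty_Ico.2 K.left_endpoint_lt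
  exact Set.disjoint_left.1 (J.pairwise_disjoint_interval_child hij) (hKi hx) (hKj hx)

lemma descendants_eq_insert (J : Dyadic) :
    J.descendants = insert J (⋃ i, (J.child i).descendants) := by
  ext K
  simp only [mem_insert_iff, mem_iUnion]
  refine ⟨eq_or_exists_mem_descendants_child, ?_⟩
  rintro (rfl | ⟨i, hi⟩)
  · exact K.mem_descendants_self
  · exact descendants_subset (J.child_mem_descendants i) hi

lemma volume_interval (J : Dyadic) : volume J.interval = 2⁻¹ ^ J.1 := by
  rw [interval, Real.volume_Ico, ← sub_div, add_sub_cancel_left, one_div, ← inv_pow,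
    ENNReal.ofReal_pow (by positivity), ENNReal.ofReal_inv_of_pos two_pos, ENNReal.ofReal_ofNat]

lemma volume_interval_child (J : Dyadic) (i : Fin 2) :
    volume (J.child i).interval = 2⁻¹ * volume J.interval := by
  rw [volume_interval, volume_interval, child, pow_succ']

lemma volume_interval_ne_zero (J : Dyadic) : volume J.interval ≠ 0 := by
  simp [volume_interval]

lemma volume_interval_ne_top (J : Dyadic) : volume J.interval ≠ ∞ := measure_Ico_lt_top.ne

end Dyadic

/-! ### Averages, Carleson densities and localized operators -/

/-- The sum of `g` over `D(J)`. -/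
def descendantSum (g : Dyadic → ℝ≥0∞) (J : Dyadic) : ℝ≥0∞ := ∑' K : J.descendants, g K

lemma descendantSum_root (g : Dyadic → ℝ≥0∞) : descendantSum g Dyadic.root = ∑' K, g K := by
  have huniv : Dyadic.root.descendants = univ := eq_univ_of_forall Dyadic.mem_descendants_root
  rw [descendantSum, huniv, tsum_univ]

lemma descendantSum_eq_add_sum (g : Dyadic → ℝ≥0∞) (J : Dyadic) :
    descendantSum g J = g J + ∑ i, descendantSum g (J.child i) := by
  have hJ : J ∉ ⋃ i, (J.child i).descendants := by
    simpa only [mem_iUnion, not_exists] using J.notMem_descendants_child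
  rw [descendantSum, J.descendants_eq_insert, insert_eq,
    ENNReal.summable.tsum_union_disjoint (Set.disjoint_singleton_left.2 hJ) ENNReal.summable,
    tsum_singleton, ENNReal.tsum_biUnion (J.pairwise_disjoint_descendants_child.set_pairwise _),
    tsum_fintype]
  rfl

lemma descendantSum_congr {g h : Dyadic → ℝ≥0∞} {J : Dyadic} (H : EqOn g h J.descendants) :
    descendantSum g J = descendantSum h J :=
  tsum_congr fun K => H K.2

lemma descendantSum_mono {g h : Dyadic → ℝ≥0∞} (H : g ≤ h) (J : Dyadic) :
    descendantSum g J ≤ descendantSum h J :=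
  ENNReal.tsum_le_tsum fun K => H K

lemma descendantSum_eq_zero {g : Dyadic → ℝ≥0∞} {J : Dyadic} (H : ∀ K ∈ J.descendants, g K = 0) :
    descendantSum g J = 0 :=
  ENNReal.tsum_eq_zero.2 fun K => H K K.2

/-- The ratio `|J|⁻¹ ∑_{K ∈ D(J)} α_K |K|` whose supremum over `J` is the Carleson constant. -/
def carlesonDensity (α : Dyadic → ℝ≥0) (J : Dyadic) : ℝ≥0∞ :=
  descendantSum (fun K => α K * volume K.interval) J / volume J.interval

variable {α β : Dyadic → ℝ≥0} {f g : ℝ → ℝ} {J K : Dyadic} {lam : ℝ}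

lemma carlesonDensity_congr (h : EqOn α β J.descendants) :
    carlesonDensity α J = carlesonDensity β J := by
  rw [carlesonDensity, descendantSum_congr fun K hK => by rw [h hK], ← carlesonDensity]

lemma carlesonDensity_mono (h : α ≤ β) (J : Dyadic) :
    carlesonDensity α J ≤ carlesonDensity β J := by
  refine ENNReal.div_le_div_right (descendantSum_mono (fun K => ?_) J) _
  gcongr
  exact h K

lemma carlesonDensity_eq_zero (h : ∀ K ∈ J.descendants, α K = 0) : carlesonDensity α J = 0 := by
  rw [carlesonDensity, descendantSum_eq_zero fun K hK => by simp [h K hK], ENNReal.zero_div]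

lemma carlesonDensity_eq_sum_add (α : Dyadic → ℝ≥0) (J : Dyadic) :
    carlesonDensity α J = ∑ i, 2⁻¹ * carlesonDensity α (J.child i) + α J := by
  have hchild (i : Fin 2) : 2⁻¹ * carlesonDensity α (J.child i) =
      descendantSum (fun K => α K * volume K.interval) (J.child i) / volume J.interval := by
    rw [carlesonDensity, J.volume_interval_child, div_eq_mul_inv,
      ENNReal.mul_inv (.inl (by simp)) (.inl (by simp)), inv_inv, mul_left_comm, ← mul_assoc 2⁻¹,
      ENNReal.inv_mul_cancel two_ne_zero ENNReal.ofNat_ne_top, one_mul, div_eq_mul_inv]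
  simp only [hchild]
  rw [carlesonDensity, descendantSum_eq_add_sum, add_comm, ENNReal.add_div,
    ENNReal.mul_div_cancel_right J.volume_interval_ne_zero J.volume_interval_ne_top]
  simp only [div_eq_mul_inv, Finset.sum_mul]

lemma carlesonDensity_ne_top_of_child (h : ∀ i, carlesonDensity α (J.child i) ≠ ∞) :
    carlesonDensity α J ≠ ∞ := by
  rw [carlesonDensity_eq_sum_add]
  exact ENNReal.add_ne_top.2 ⟨ENNReal.sum_ne_top.2 fun i _ => ENNReal.mul_ne_top (by simp) (h i),
    ENNReal.coe_ne_top⟩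

lemma toReal_carlesonDensity_eq_sum_add (h : carlesonDensity α J ≠ ∞) :
    (carlesonDensity α J).toReal =
      ∑ i, 2⁻¹ * (carlesonDensity α (J.child i)).toReal + α J := by
  rw [carlesonDensity_eq_sum_add] at h ⊢
  have hsum := (ENNReal.add_ne_top.1 h).1
  rw [ENNReal.toReal_add hsum ENNReal.coe_ne_top,
    ENNReal.toReal_sum fun i _ => (ENNReal.sum_ne_top.1 hsum) i (Finset.mem_univ i)]
  simp

lemma setAverage_congr_of_mem_descendants (h : EqOn f g J.interval) (hK : K ∈ J.descendants) :
    ⨍ y in K.interval, f y = ⨍ y in K.interval, g y := by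
  rw [setAverage_eq, setAverage_eq, setIntegral_congr_fun K.measurableSet_interval (h.mono hK)]

lemma setAverage_eq_sum (hf : IntegrableOn f J.interval) :
    ⨍ y in J.interval, f y = ∑ i, 2⁻¹ * ⨍ y in (J.child i).interval, f y := by
  have hchild (i : Fin 2) : 2⁻¹ * ⨍ y in (J.child i).interval, f y =
      (volume.real J.interval)⁻¹ * ∫ y in (J.child i).interval, f y := by
    rw [setAverage_eq, measureReal_def, J.volume_interval_child, ENNReal.toReal_mul, smul_eq_mul,
      ENNReal.toReal_inv, ENNReal.toReal_ofNat, mul_inv, inv_inv, ← measureReal_def]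
    ring
  simp only [hchild, ← Finset.mul_sum]
  rw [setAverage_eq, smul_eq_mul, ← J.iUnion_interval_child, integral_iUnion_fintype
    (fun i => (J.child i).measurableSet_interval) J.pairwise_disjoint_interval_child
    fun i => hf.mono_set (J.child_mem_descendants i)]

/-- The summand of `lernerOp` at the interval `K`. -/
def lernerTerm (α : Dyadic → ℝ≥0) (f : ℝ → ℝ) (x : ℝ) (K : Dyadic) : ℝ≥0∞ :=
  K.interval.indicator (fun _ => (α K : ℝ≥0∞) * ENNReal.ofReal (⨍ y in K.interval, f y)) x

/-- The part of `lernerOp` coming from the intervals contained in `J`. -/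
def localOp (α : Dyadic → ℝ≥0) (f : ℝ → ℝ) (J : Dyadic) (x : ℝ) : ℝ≥0∞ :=
  descendantSum (lernerTerm α f x) J

lemma lernerTerm_mono (h : α ≤ β) (f : ℝ → ℝ) (x : ℝ) : lernerTerm α f x ≤ lernerTerm β f x := by
  refine fun K => indicator_le_indicator ?_
  gcongr
  exact h K

lemma localOp_root (α : Dyadic → ℝ≥0) (f : ℝ → ℝ) : localOp α f Dyadic.root = lernerOp α f :=
  funext fun x => descendantSum_root (lernerTerm α f x)

lemma localOp_congr (hα : EqOn α β J.descendants) (hf : EqOn f g J.interval) (x : ℝ) :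
    localOp α f J x = localOp β g J x :=
  descendantSum_congr fun K hK => by
    rw [lernerTerm, lernerTerm, hα hK, setAverage_congr_of_mem_descendants hf hK]

lemma localOp_eq_zero_of_notMem {x : ℝ} (hx : x ∉ J.interval) : localOp α f J x = 0 :=
  descendantSum_eq_zero fun _ hK => indicator_of_notMem (fun hxK => hx (hK hxK)) _

lemma localOp_of_mem_child {x : ℝ} {i : Fin 2} (hx : x ∈ (J.child i).interval) :
    localOp α f J x =
      α J * ENNReal.ofReal (⨍ y in J.interval, f y) + localOp α f (J.child i) x := by
  rw [localOp, descendantSum_eq_add_sum, lernerTerm,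
    indicator_of_mem (J.child_mem_descendants i hx)]
  congr 1
  refine Finset.sum_eq_single i (fun j _ hj => localOp_eq_zero_of_notMem ?_) (by simp)
  exact Set.disjoint_right.1 (J.pairwise_disjoint_interval_child hj) hx

lemma measurable_localOp (α : Dyadic → ℝ≥0) (f : ℝ → ℝ) (J : Dyadic) :
    Measurable (localOp α f J) :=
  Measurable.tsum fun K => measurable_const.indicator K.1.measurableSet_interval

/-- The superlevel set of the localized operator inside `J`. -/
def levelSet (α : Dyadic → ℝ≥0) (f : ℝ → ℝ) (J : Dyadic) (lam : ℝ) : Set ℝ :=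
  {x | x ∈ J.interval ∧ ENNReal.ofReal lam < localOp α f J x}

lemma levelSet_subset_interval (α : Dyadic → ℝ≥0) (f : ℝ → ℝ) (J : Dyadic) (lam : ℝ) :
    levelSet α f J lam ⊆ J.interval := fun _ hx => hx.1

lemma measurableSet_levelSet (α : Dyadic → ℝ≥0) (f : ℝ → ℝ) (J : Dyadic) (lam : ℝ) :
    MeasurableSet (levelSet α f J lam) :=
  J.measurableSet_interval.inter (measurableSet_lt measurable_const (measurable_localOp α f J))

lemma distrib_lernerOp (α : Dyadic → ℝ≥0) (f : ℝ → ℝ) (lam : ℝ) :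
    distrib (lernerOp α f) lam = volume (levelSet α f Dyadic.root lam) := by
  rw [distrib, levelSet, localOp_root, Dyadic.interval_root]

lemma levelSet_congr (hα : EqOn α β J.descendants) (hf : EqOn f g J.interval) (lam : ℝ) :
    levelSet α f J lam = levelSet β g J lam := by
  simp only [levelSet, localOp_congr hα hf]

lemma levelSet_mono (h : α ≤ β) (f : ℝ → ℝ) (J : Dyadic) (lam : ℝ) :
    levelSet α f J lam ⊆ levelSet β f J lam :=
  fun x hx => ⟨hx.1, hx.2.trans_le (descendantSum_mono (lernerTerm_mono h f x) J)⟩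

lemma levelSet_add (hF : 0 ≤ ⨍ y in J.interval, f y) (hlam : 0 ≤ lam) :
    levelSet α f J (lam + α J * ⨍ y in J.interval, f y) =
      ⋃ i, levelSet α f (J.child i) lam := by
  have hlt {i : Fin 2} {x : ℝ} (hx : x ∈ (J.child i).interval) :
      ENNReal.ofReal (lam + α J * ⨍ y in J.interval, f y) < localOp α f J x ↔
        ENNReal.ofReal lam < localOp α f (J.child i) x := by
    rw [localOp_of_mem_child hx, ENNReal.ofReal_add hlam (by positivity),
      ENNReal.ofReal_mul (α J).coe_nonneg, ENNReal.ofReal_coe_nnreal, add_comm]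
    exact ENNReal.add_lt_add_iff_left (ENNReal.mul_ne_top ENNReal.coe_ne_top ENNReal.ofReal_ne_top)
  ext x
  simp only [levelSet, mem_iUnion, mem_ofPred_eq]
  constructor
  · rintro ⟨hx, h⟩
    rw [← J.iUnion_interval_child] at hx
    obtain ⟨i, hi⟩ := mem_iUnion.1 hx
    exact ⟨i, hi, (hlt hi).1 h⟩
  · rintro ⟨i, hi, h⟩
    exact ⟨J.child_mem_descendants i hi, (hlt hi).2 h⟩

lemma volume_levelSet_add (hF : 0 ≤ ⨍ y in J.interval, f y) (hlam : 0 ≤ lam) :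
    volume (levelSet α f J (lam + α J * ⨍ y in J.interval, f y)) =
      ∑ i, volume (levelSet α f (J.child i) lam) := by
  rw [levelSet_add hF hlam, measure_iUnion _ fun i => measurableSet_levelSet α f _ lam,
    tsum_fintype]
  exact fun i j hij => (J.pairwise_disjoint_interval_child hij).mono
    (levelSet_subset_interval _ _ _ _) (levelSet_subset_interval _ _ _ _)

/-! ### The upper bound -/

/-- The assertion that at every positive level the superlevel set of the operator localized to `J`
fills at most the fraction of `J` prescribed by the Bellman function. -/
def BellmanBound (α : Dyadic → ℝ≥0) (f : ℝ → ℝ) (J : Dyadic) : Prop :=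
  ∀ lam : ℝ, 0 < lam → volume (levelSet α f J lam) ≤
    ENNReal.ofReal (bellman ((⨍ y in J.interval, f y) / lam) (carlesonDensity α J).toReal) *
      volume J.interval

lemma le_toReal_carlesonDensity (h : carlesonDensity α J ≠ ∞) :
    (α J : ℝ) ≤ (carlesonDensity α J).toReal := by
  rw [toReal_carlesonDensity_eq_sum_add h]
  exact le_add_of_nonneg_left (by positivity)

lemma sum_bellman_child_le (hf : IntegrableOn f J.interval)
    (hF : ∀ i, 0 ≤ ⨍ y in (J.child i).interval, f y) (hα : carlesonDensity α J ≤ 1)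
    (hlam : α J * ⨍ y in J.interval, f y < lam) :
    ∑ i, 2⁻¹ * bellman
        ((⨍ y in (J.child i).interval, f y) / (lam - α J * ⨍ y in J.interval, f y))
        (carlesonDensity α (J.child i)).toReal ≤
      bellman ((⨍ y in J.interval, f y) / lam) (carlesonDensity α J).toReal := by
  have hdensity :=
    toReal_carlesonDensity_eq_sum_add (ne_top_of_le_ne_top ENNReal.one_ne_top hα)
  have hone : (carlesonDensity α J).toReal ≤ 1 :=
    ENNReal.toReal_le_of_le_ofReal zero_le_one (by simpa)
  rw [setAverage_eq_sum hf] at hlam ⊢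
  rw [hdensity] at hone ⊢
  exact sum_bellman_div_sub_le (fun _ _ => by norm_num) (by norm_num) (fun i _ => hF i)
    (fun _ _ => ENNReal.toReal_nonneg) (α J).coe_nonneg hone hlam

lemma bellmanBound_of_child (hf : IntegrableOn f J.interval)
    (hF : ∀ i, 0 ≤ ⨍ y in (J.child i).interval, f y) (hα : carlesonDensity α J ≤ 1)
    (h : ∀ i, BellmanBound α f (J.child i)) : BellmanBound α f J := by
  intro lam hlam
  have hF0 : 0 ≤ ⨍ y in J.interval, f y := by
    rw [setAverage_eq_sum hf]
    exact Finset.sum_nonneg fun i _ => mul_nonneg (by norm_num) (hF i)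
  have hsum := sum_bellman_child_le (lam := lam) hf hF hα
  set F := ⨍ y in J.interval, f y
  rcases le_or_gt lam (α J * F) with hle | hgt
  · have hone : 1 ≤ F / lam * (carlesonDensity α J).toReal := by
      rw [div_mul_eq_mul_div, one_le_div hlam, mul_comm F]
      exact hle.trans (mul_le_mul_of_nonneg_right
        (le_toReal_carlesonDensity (ne_top_of_le_ne_top ENNReal.one_ne_top hα)) hF0)
    rw [bellman_eq_one (by positivity)
      (ENNReal.toReal_le_of_le_ofReal zero_le_one (by simpa)) hone, ENNReal.ofReal_one, one_mul]
    exact measure_mono (levelSet_subset_interval α f J lam)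
  · have hgt' : 0 < lam - α J * F := sub_pos.2 hgt
    calc volume (levelSet α f J lam)
        = ∑ i, volume (levelSet α f (J.child i) (lam - α J * F)) := by
          rw [← volume_levelSet_add hF0 hgt'.le, sub_add_cancel]
      _ ≤ ∑ i, ENNReal.ofReal (2⁻¹ * bellman
            ((⨍ y in (J.child i).interval, f y) / (lam - α J * F))
            (carlesonDensity α (J.child i)).toReal) * volume J.interval := by
          refine Finset.sum_le_sum fun i _ => (h i _ hgt').trans_eq ?_
          rw [J.volume_interval_child, ENNReal.ofReal_mul (by norm_num),
            ENNReal.ofReal_inv_of_pos two_pos, ENNReal.ofReal_ofNat]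
          ring
      _ ≤ _ := by
          rw [← Finset.sum_mul, ← ENNReal.ofReal_sum_of_nonneg fun i _ => mul_nonneg (by norm_num)
            (bellman_nonneg (div_nonneg (hF i) hgt'.le) ENNReal.toReal_nonneg)]
          gcongr
          exact hsum hgt

lemma bellmanBound_of_forall_eq_zero (h : ∀ K ∈ J.descendants, α K = 0) : BellmanBound α f J := by
  intro lam _
  have hempty : levelSet α f J lam = ∅ := by
    refine eq_empty_of_forall_notMem fun x hx => not_lt_zero (hx.2.trans_eq ?_)
    exact descendantSum_eq_zero fun K hK => by simp [lernerTerm, h K hK]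
  simp [hempty]

lemma bellmanBound_of_eq_zero_of_le {N : ℕ} (hf : IntegrableOn f J.interval)
    (hF : ∀ K ∈ J.descendants, 0 ≤ ⨍ y in K.interval, f y)
    (hα : ∀ K ∈ J.descendants, carlesonDensity α K ≤ 1)
    (hN : ∀ K : Dyadic, N ≤ K.1 → α K = 0) : BellmanBound α f J := by
  induction hd : N - J.1 generalizing J with
  | zero =>
    refine bellmanBound_of_forall_eq_zero fun K hK => hN K ?_
    have := Dyadic.level_le_of_mem_descendants hK
    omega
  | succ d ih =>
    have hsub (i : Fin 2) := Dyadic.descendants_subset (J.child_mem_descendants i)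
    refine bellmanBound_of_child hf (fun i => hF _ (J.child_mem_descendants i))
      (hα J J.mem_descendants_self) fun i => ih (hf.mono_set (J.child_mem_descendants i))
        (fun K hK => hF K (hsub i hK)) (fun K hK => hα K (hsub i hK)) ?_
    change N - (J.1 + 1) = d
    omega

/-- The sequence `α` cut off after its first `N` generations. -/
def truncate (α : Dyadic → ℝ≥0) (N : ℕ) : Dyadic → ℝ≥0 := {K : Dyadic | K.1 < N}.indicator α

lemma truncate_of_lt {N : ℕ} (h : K.1 < N) : truncate α N K = α K :=
  indicator_of_mem (s := {K : Dyadic | K.1 < N}) h α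

lemma truncate_of_le {N : ℕ} (h : N ≤ K.1) : truncate α N K = 0 :=
  indicator_of_notMem (s := {K : Dyadic | K.1 < N}) h.not_gt α

lemma truncate_le (α : Dyadic → ℝ≥0) (N : ℕ) : truncate α N ≤ α :=
  indicator_le_self' fun _ _ => zero_le

lemma monotone_truncate (α : Dyadic → ℝ≥0) : Monotone (truncate α) := fun _ _ h =>
  indicator_le_indicator_of_subset (fun _ hK => lt_of_lt_of_le hK h) fun _ => zero_le

lemma levelSet_subset_iUnion_truncate (α : Dyadic → ℝ≥0) (f : ℝ → ℝ) (J : Dyadic) (lam : ℝ) :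
    levelSet α f J lam ⊆ ⋃ N, levelSet (truncate α N) f J lam := by
  rintro x ⟨hxJ, hx⟩
  rw [localOp, descendantSum, ENNReal.tsum_eq_iSup_sum, lt_iSup_iff] at hx
  obtain ⟨s, hs⟩ := hx
  let N := s.sup (fun K => K.1.1) + 1
  refine mem_iUnion.2 ⟨N, hxJ, hs.trans_le ?_⟩
  have htrunc : ∀ K ∈ s, lernerTerm α f x K = lernerTerm (truncate α N) f x K := fun K hK => by
    have hKN : K.1.1 < N := Nat.lt_succ_of_le (Finset.le_sup (f := fun K => K.1.1) hK)
    rw [lernerTerm, lernerTerm, truncate_of_lt hKN]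
  rw [Finset.sum_congr rfl htrunc]
  exact ENNReal.sum_le_tsum s

theorem bellmanBound (hf : IntegrableOn f J.interval)
    (hF : ∀ K ∈ J.descendants, 0 ≤ ⨍ y in K.interval, f y)
    (hα : ∀ K ∈ J.descendants, carlesonDensity α K ≤ 1) : BellmanBound α f J := by
  intro lam hlam
  have hmono : Monotone fun N => levelSet (truncate α N) f J lam :=
    fun _ _ h => levelSet_mono (monotone_truncate α h) f J lam
  refine (measure_mono (levelSet_subset_iUnion_truncate α f J lam)).trans ?_
  rw [hmono.measure_iUnion]
  refine iSup_le fun N => ?_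
  have hle (K : Dyadic) : carlesonDensity (truncate α N) K ≤ carlesonDensity α K :=
    carlesonDensity_mono (truncate_le α N) K
  have hbound : BellmanBound (truncate α N) f J :=
    bellmanBound_of_eq_zero_of_le hf hF (fun K hK => (hle K).trans (hα K hK))
      fun _ hK => truncate_of_le hK
  refine (hbound lam hlam).trans ?_
  gcongr
  exact bellman_mono_right (div_nonneg (hF J J.mem_descendants_self) hlam.le)
    ENNReal.toReal_nonneg (ENNReal.toReal_mono
      (ne_top_of_le_ne_top ENNReal.one_ne_top (hα J J.mem_descendants_self)) (hle J))

lemma NonnegL1.setAverage_nonneg (hf : NonnegL1 f) (J : Dyadic) :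
    0 ≤ ⨍ y in J.interval, f y := by
  rw [setAverage_eq]
  refine smul_nonneg (by positivity) (integral_nonneg_of_ae (ae_mono ?_ hf.2))
  exact Measure.restrict_mono_set _ (Dyadic.interval_root ▸ J.mem_descendants_root)

lemma NonnegL1.normL1_eq (hf : NonnegL1 f) : normL1 f = ⨍ y in Dyadic.root.interval, f y := by
  rw [setAverage_eq, measureReal_def, Dyadic.volume_interval, Dyadic.interval_root]
  simpa [normL1, Dyadic.root] using integral_congr_ae (hf.2.mono fun _ hx => abs_of_nonneg hx)

lemma normL1_nonneg (f : ℝ → ℝ) : 0 ≤ normL1 f := integral_nonneg fun _ => abs_nonneg _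

lemma carlesonConst_le_one_iff : carlesonConst α ≤ 1 ↔ ∀ J, carlesonDensity α J ≤ 1 := iSup_le_iff

theorem distrib_lernerOp_le (hf : NonnegL1 f) (hα : carlesonConst α ≤ 1) (hlam : 0 < lam) :
    distrib (lernerOp α f) lam ≤ ENNReal.ofReal (levelBound (normL1 f) lam) := by
  rw [carlesonConst_le_one_iff] at hα
  have hbound := bellmanBound (J := Dyadic.root) (Dyadic.interval_root.symm ▸ hf.1)
    (fun K _ => hf.setAverage_nonneg K) (fun K _ => hα K) lam hlam
  rw [← hf.normL1_eq, Dyadic.interval_root, Real.volume_Ico, sub_zero, ENNReal.ofReal_one,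
    mul_one] at hbound
  rw [distrib_lernerOp, ← bellman_div_one (normL1_nonneg f) hlam]
  refine hbound.trans (ENNReal.ofReal_le_ofReal ?_)
  exact bellman_mono_right (div_nonneg (normL1_nonneg f) hlam.le) ENNReal.toReal_nonneg
    (ENNReal.toReal_le_of_le_ofReal zero_le_one (by simpa using hα Dyadic.root))

lemma mul_levelBound_le {t : ℝ} (ht : 0 ≤ t) (hlam : 0 < lam) : lam * levelBound t lam ≤ 2 * t := by
  unfold levelBound
  split_ifs with h
  · rw [← mul_div_assoc, div_le_iff₀ (by linarith)]
    nlinarith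
  · linarith

theorem weakL1_lernerOp_le (hf : NonnegL1 f) (hα : carlesonConst α ≤ 1) :
    weakL1 (lernerOp α f) ≤ 2 * ENNReal.ofReal (normL1 f) := by
  refine iSup₂_le fun lam hlam => ?_
  calc ENNReal.ofReal lam * distrib (lernerOp α f) lam
      ≤ ENNReal.ofReal lam * ENNReal.ofReal (levelBound (normL1 f) lam) := by
        gcongr
        exact distrib_lernerOp_le hf hα hlam
    _ = ENNReal.ofReal (lam * levelBound (normL1 f) lam) := (ENNReal.ofReal_mul hlam.le).symm
    _ ≤ ENNReal.ofReal (2 * normL1 f) :=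
        ENNReal.ofReal_le_ofReal (mul_levelBound_le (normL1_nonneg f) hlam)
    _ = 2 * ENNReal.ofReal (normL1 f) := by
        rw [ENNReal.ofReal_mul zero_le_two, ENNReal.ofReal_ofNat]

/-! ### Near-extremizers -/

/-- The function `f` and the sequence `α` are admissible on `J` and have average `x` and Carleson
density `A` there, and the superlevel set at `lam` fills at least the fraction `v` of `J`. -/
structure IsWitness (J : Dyadic) (x A lam v : ℝ) (f : ℝ → ℝ) (α : Dyadic → ℝ≥0) : Prop where
  nonneg : ∀ y ∈ J.interval, 0 ≤ f y
  integrableOn : IntegrableOn f J.interval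
  setAverage : ⨍ y in J.interval, f y = x
  toReal_density : (carlesonDensity α J).toReal = A
  density_le_one : ∀ K ∈ J.descendants, carlesonDensity α K ≤ 1
  le_volume : ENNReal.ofReal v * volume J.interval ≤ volume (levelSet α f J lam)

/-- The quadruples for which the extremal problem has witnesses on every dyadic interval. Asking
for all intervals at once replaces rescaling of functions and sequences. -/
def Achievable (x A lam v : ℝ) : Prop := ∀ J, ∃ f α, IsWitness J x A lam v f α

section Witness

variable {x A v : ℝ}

lemma IsWitness.congr (h : IsWitness J x A lam v f α) (hf : EqOn g f J.interval)
    (hα : EqOn β α J.descendants) : IsWitness J x A lam v g β where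
  nonneg y hy := (h.nonneg y hy).trans_eq (hf hy).symm
  integrableOn := h.integrableOn.congr_fun hf.symm J.measurableSet_interval
  setAverage := by
    rw [setAverage_congr_of_mem_descendants hf J.mem_descendants_self, h.setAverage]
  toReal_density := by rw [carlesonDensity_congr hα, h.toReal_density]
  density_le_one K hK := by
    rw [carlesonDensity_congr (hα.mono (Dyadic.descendants_subset hK))]
    exact h.density_le_one K hK
  le_volume := by
    rw [levelSet_congr hα hf]
    exact h.le_volume

lemma IsWitness.of_child {x A v : Fin 2 → ℝ}
    (h : ∀ i, IsWitness (J.child i) (x i) (A i) lam (v i) f α)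
    (hα : ∑ i, 2⁻¹ * A i + α J ≤ 1) (hlam : 0 ≤ lam) :
    IsWitness J (∑ i, 2⁻¹ * x i) (∑ i, 2⁻¹ * A i + α J) (lam + α J * ∑ i, 2⁻¹ * x i)
      (∑ i, 2⁻¹ * v i) f α := by
  have hnonneg : ∀ y ∈ J.interval, 0 ≤ f y := fun y hy => by
    rw [← J.iUnion_interval_child] at hy
    obtain ⟨i, hi⟩ := mem_iUnion.1 hy
    exact (h i).nonneg y hi
  have hf : IntegrableOn f J.interval := by
    rw [← J.iUnion_interval_child]
    exact integrableOn_finite_iUnion.2 fun i => (h i).integrableOn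
  have havg : ⨍ y in J.interval, f y = ∑ i, 2⁻¹ * x i := by
    simp only [setAverage_eq_sum hf, (h _).setAverage]
  have havg0 : 0 ≤ ⨍ y in J.interval, f y := by
    rw [setAverage_eq]
    exact smul_nonneg (by positivity) (setIntegral_nonneg J.measurableSet_interval hnonneg)
  have htop : carlesonDensity α J ≠ ∞ := carlesonDensity_ne_top_of_child fun i =>
    ne_top_of_le_ne_top ENNReal.one_ne_top
      ((h i).density_le_one _ (Dyadic.mem_descendants_self _))
  have hdensity : (carlesonDensity α J).toReal = ∑ i, 2⁻¹ * A i + α J := by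
    simp only [toReal_carlesonDensity_eq_sum_add htop, (h _).toReal_density]
  refine ⟨hnonneg, hf, havg, hdensity, fun K hK => ?_, ?_⟩
  · rcases Dyadic.eq_or_exists_mem_descendants_child hK with rfl | ⟨i, hi⟩
    · rw [← ENNReal.ofReal_toReal htop, hdensity]
      exact ENNReal.ofReal_le_one.2 hα
    · exact (h i).density_le_one K hi
  · rw [← havg, volume_levelSet_add havg0 hlam]
    refine le_trans ?_ (Finset.sum_le_sum fun i _ => (h i).le_volume)
    simp only [J.volume_interval_child, Fin.sum_univ_two]
    refine (mul_le_mul_left ENNReal.ofReal_add_le _).trans_eq ?_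
    simp only [ENNReal.ofReal_mul (by norm_num : (0 : ℝ) ≤ 2⁻¹),
      ENNReal.ofReal_inv_of_pos two_pos, ENNReal.ofReal_ofNat]
    ring

/-- The sequence with the entry `a` at `J` that agrees with `α i` below the child `i` of `J`. -/
def glueSeq (J : Dyadic) (a : ℝ≥0) (α : Fin 2 → Dyadic → ℝ≥0) : Dyadic → ℝ≥0 :=
  open Classical in Function.update ((J.child 0).descendants.piecewise (α 0) (α 1)) J a

/-- The function that agrees with `f i` on the child `i` of `J`. -/
def glueFun (J : Dyadic) (f : Fin 2 → ℝ → ℝ) : ℝ → ℝ :=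
  open Classical in (J.child 0).interval.piecewise (f 0) (f 1)

lemma glueSeq_self (J : Dyadic) (a : ℝ≥0) (α : Fin 2 → Dyadic → ℝ≥0) : glueSeq J a α J = a :=
  Function.update_self ..

lemma eqOn_glueSeq (J : Dyadic) (a : ℝ≥0) (α : Fin 2 → Dyadic → ℝ≥0) (i : Fin 2) :
    EqOn (glueSeq J a α) (α i) (J.child i).descendants := by
  classical
  intro K hK
  have hne : K ≠ J := by
    rintro rfl
    exact K.notMem_descendants_child i hK
  rw [glueSeq, Function.update_of_ne hne]
  fin_cases i
  · exact piecewise_eq_of_mem _ _ _ hK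
  · exact piecewise_eq_of_notMem _ _ _
      (Set.disjoint_right.1 (J.pairwise_disjoint_descendants_child zero_ne_one) hK)

lemma eqOn_glueFun (J : Dyadic) (f : Fin 2 → ℝ → ℝ) (i : Fin 2) :
    EqOn (glueFun J f) (f i) (J.child i).interval := by
  classical
  intro y hy
  fin_cases i
  · exact piecewise_eq_of_mem _ _ _ hy
  · exact piecewise_eq_of_notMem _ _ _ (Set.disjoint_right.1 J.disjoint_interval_child hy)

lemma Achievable.glue {x A v : Fin 2 → ℝ} {a : ℝ≥0}
    (h : ∀ i, Achievable (x i) (A i) lam (v i)) (ha : ∑ i, 2⁻¹ * A i + a ≤ 1) (hlam : 0 ≤ lam) :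
    Achievable (∑ i, 2⁻¹ * x i) (∑ i, 2⁻¹ * A i + a) (lam + a * ∑ i, 2⁻¹ * x i)
      (∑ i, 2⁻¹ * v i) := by
  intro J
  choose f α hw using fun i => h i (J.child i)
  refine ⟨glueFun J f, glueSeq J a α, ?_⟩
  have hchild (i : Fin 2) := (hw i).congr (eqOn_glueFun J f i) (eqOn_glueSeq J a α i)
  have hJ := IsWitness.of_child hchild (by rwa [glueSeq_self]) hlam
  rwa [glueSeq_self] at hJ

lemma Achievable.le_one (h : Achievable x A lam v) : A ≤ 1 := by
  obtain ⟨f, α, hw⟩ := h Dyadic.root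
  rw [← hw.toReal_density]
  exact ENNReal.toReal_le_of_le_ofReal zero_le_one
    (by simpa using hw.density_le_one _ (Dyadic.mem_descendants_self _))

lemma Achievable.midpoint {x' A' v' : ℝ} (h : Achievable x A lam v) (h' : Achievable x' A' lam v')
    (hlam : 0 ≤ lam) : Achievable ((x + x') / 2) ((A + A') / 2) lam ((v + v') / 2) := by
  have hglue := Achievable.glue (x := ![x, x']) (A := ![A, A']) (v := ![v, v']) (a := 0)
    (Fin.forall_fin_two.2 ⟨h, h'⟩) (by simpa using by linarith [h.le_one, h'.le_one]) hlam
  convert hglue using 1 <;> simp <;> ring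

lemma Achievable.raise (h : Achievable x A lam v) {a : ℝ≥0} (ha : A + a ≤ 1) (hlam : 0 ≤ lam) :
    Achievable x (A + a) (lam + a * x) v := by
  have hglue := Achievable.glue (fun _ => h) (a := a) (by simpa using by linarith) hlam
  convert hglue using 1 <;> simp

lemma achievable_zero (lam : ℝ) : Achievable 0 0 lam 0 := fun J =>
  ⟨0, 0, fun _ _ => le_rfl, integrableOn_zero, by simp,
    by simp [carlesonDensity_eq_zero], fun K _ => by simp [carlesonDensity_eq_zero], by simp⟩

lemma achievable_one {y : ℝ} (hy : 0 < y) (h : lam < y) : Achievable y 1 lam 1 := by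
  classical
  intro J
  set α : Dyadic → ℝ≥0 := Pi.single J 1
  have havg : ⨍ _ in J.interval, y = y :=
    setAverage_const J.volume_interval_ne_zero J.volume_interval_ne_top y
  have hchild (i : Fin 2) : ∀ K ∈ (J.child i).descendants, carlesonDensity α K = 0 := by
    refine fun K hK => carlesonDensity_eq_zero fun L hL => Pi.single_eq_of_ne ?_ 1
    rintro rfl
    exact L.notMem_descendants_child i (Dyadic.descendants_subset hK hL)
  have hJ : carlesonDensity α J = 1 := by
    rw [carlesonDensity_eq_sum_add]
    simp [hchild _ _ (Dyadic.mem_descendants_self _), α]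
  refine ⟨fun _ => y, α, fun _ _ => hy.le, integrableOn_const J.volume_interval_ne_top, havg,
    by rw [hJ, ENNReal.toReal_one], fun K hK => ?_, ?_⟩
  · rcases Dyadic.eq_or_exists_mem_descendants_child hK with rfl | ⟨i, hi⟩
    · exact hJ.le
    · exact (hchild i K hi).trans_le zero_le_one
  · rw [ENNReal.ofReal_one, one_mul]
    refine measure_mono fun x hx => ⟨hx, ?_⟩
    obtain ⟨i, hi⟩ := mem_iUnion.1 (J.iUnion_interval_child.symm ▸ hx)
    rw [localOp_of_mem_child hi, havg, show α J = 1 from Pi.single_eq_same J 1,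
      ENNReal.coe_one, one_mul]
    exact ((ENNReal.ofReal_lt_ofReal_iff hy).2 h).trans_le le_self_add

end Witness

/-- The proportion of an interval that remains when a descendant `m` generations below it is
removed: the part on which a witness is kept when it is diluted. -/
def dilutionRatio (m : ℕ) : ℝ := 1 - (1 / 2) ^ m

lemma dilutionRatio_pos {m : ℕ} (hm : m ≠ 0) : 0 < dilutionRatio m :=
  sub_pos.2 (pow_lt_one₀ (by norm_num) (by norm_num) hm)

lemma dilutionRatio_lt_one (m : ℕ) : dilutionRatio m < 1 := sub_lt_self _ (by positivity)

lemma tendsto_dilutionRatio : Filter.Tendsto dilutionRatio Filter.atTop (nhds 1) := by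
  have hpow := tendsto_pow_atTop_nhds_zero_of_lt_one (r := (1 : ℝ) / 2) (by norm_num) (by norm_num)
  have h := hpow.const_sub 1
  rw [sub_zero] at h
  exact h

lemma Achievable.dilute {x A v : ℝ} (h : Achievable x A lam v) (hlam : 0 ≤ lam) (m : ℕ) :
    Achievable (dilutionRatio m * x) (dilutionRatio m * A) lam (dilutionRatio m * v) := by
  induction m with
  | zero => simpa [dilutionRatio] using achievable_zero lam
  | succ m ih =>
    have hsucc : dilutionRatio (m + 1) = (1 + dilutionRatio m) / 2 := by
      rw [dilutionRatio, dilutionRatio, pow_succ]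
      ring
    convert h.midpoint ih hlam using 1 <;> rw [hsucc] <;> ring

lemma Achievable.dilute_raise {x v : ℝ} (h : Achievable x 1 lam v) (hlam : 0 ≤ lam) (m : ℕ) :
    Achievable (dilutionRatio m * x) 1
      (lam + (1 - dilutionRatio m) * (dilutionRatio m * x)) (dilutionRatio m * v) := by
  have ha : ((1 - dilutionRatio m).toNNReal : ℝ) = 1 - dilutionRatio m :=
    Real.coe_toNNReal _ (sub_nonneg.2 (dilutionRatio_lt_one m).le)
  have hraise := (h.dilute hlam m).raise (a := (1 - dilutionRatio m).toNNReal)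
    (by rw [ha]; linarith) hlam
  rwa [ha, mul_one, add_sub_cancel] at hraise

lemma achievable_dilutionRatio_pow {y : ℝ} (hlam : 0 ≤ lam) (h : lam < y) {m : ℕ} (hm : m ≠ 0)
    (k : ℕ) : Achievable (dilutionRatio m ^ k * y) 1
      (lam + dilutionRatio m * (1 - dilutionRatio m ^ k) * y) (dilutionRatio m ^ k) := by
  have hy : 0 < y := hlam.trans_lt h
  have hr0 := dilutionRatio_pos hm
  have hr1 := dilutionRatio_lt_one m
  set r := dilutionRatio m with hr
  induction k with
  | zero => simpa using achievable_one hy h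
  | succ k ih =>
    have hlevel : 0 ≤ lam + r * (1 - r ^ k) * y := by
      have : 0 ≤ 1 - r ^ k := sub_nonneg.2 (pow_le_one₀ hr0.le hr1.le)
      positivity
    have hstep := ih.dilute_raise hlevel m
    rw [← hr] at hstep
    convert hstep using 1 <;> ring

/-- Starting from a constant function just above its level, diluting and raising until the average
has decreased to `t` reaches the level `lam` for a suitable choice of the initial height. -/
lemma exists_achievable_ge {t : ℝ} (ht : 0 < t) (htl : t ≤ lam) {m : ℕ} (hm : m ≠ 0) :
    ∃ v, dilutionRatio m * ((1 + dilutionRatio m) * t / (lam + dilutionRatio m * t)) ≤ v ∧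
      Achievable t 1 lam v := by
  have hr0 := dilutionRatio_pos hm
  have hr1 := dilutionRatio_lt_one m
  set r := dilutionRatio m with hr
  have hd : 0 < lam + r * t := add_pos_of_pos_of_nonneg (ht.trans_le htl) (by positivity)
  obtain ⟨n, hlt, hle⟩ := exists_nat_pow_near_of_lt_one
    (x := (1 + r) * t / (lam + r * t)) (by positivity)
    ((div_le_one hd).2 (by linarith)) hr0 hr1
  have hmul : r * ((1 + r) * t / (lam + r * t)) ≤ r ^ (n + 1) := by
    rw [pow_succ']
    gcongr
  refine ⟨r ^ (n + 1), hmul, ?_⟩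
  have hk : 0 < r ^ (n + 1) := by positivity
  set y := t / r ^ (n + 1) with hy
  have hyt : r ^ (n + 1) * y = t := mul_div_cancel₀ t hk.ne'
  have hlevel : r ^ (n + 1) * (lam - r * (1 - r ^ (n + 1)) * y) =
      r ^ (n + 1) * (lam + r * t) - r * t := by
    linear_combination (-(r * (1 - r ^ (n + 1)))) * hyt
  have hlevel_nonneg : 0 ≤ lam - r * (1 - r ^ (n + 1)) * y := by
    rw [← mul_div_assoc, div_le_iff₀ hd] at hmul
    refine nonneg_of_mul_nonneg_right ?_ hk
    rw [hlevel]
    nlinarith [mul_nonneg hr0.le (mul_nonneg hr0.le ht.le)]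
  have hlevel_lt : lam - r * (1 - r ^ (n + 1)) * y < y := by
    rw [lt_div_iff₀ hd] at hlt
    refine lt_of_mul_lt_mul_left ?_ hk.le
    rw [hlevel, hyt]
    linarith
  have h := achievable_dilutionRatio_pow hlevel_nonneg hlevel_lt hm (n + 1)
  rwa [← hr, hyt, sub_add_cancel] at h

lemma Achievable.exists_lernerOp {t v : ℝ} (h : Achievable t 1 lam v) :
    ∃ (f : ℝ → ℝ) (α : Dyadic → ℝ≥0), NonnegL1 f ∧ normL1 f = t ∧ carlesonConst α ≤ 1 ∧
      ENNReal.ofReal v ≤ distrib (lernerOp α f) lam := by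
  obtain ⟨f, α, hw⟩ := h Dyadic.root
  have hf : NonnegL1 f := by
    rw [NonnegL1, ← Dyadic.interval_root]
    exact ⟨hw.integrableOn,
      ae_restrict_of_forall_mem Dyadic.root.measurableSet_interval hw.nonneg⟩
  refine ⟨f, α, hf, hf.normL1_eq.trans hw.setAverage,
    carlesonConst_le_one_iff.2 fun J => hw.density_le_one J J.mem_descendants_root, ?_⟩
  simpa [distrib_lernerOp, Dyadic.interval_root] using hw.le_volume

theorem isLUB_distrib_lernerOp {t : ℝ} (ht : 0 ≤ t) (hlam : 0 < lam) :
    IsLUB {m : ℝ≥0∞ | ∃ (f : ℝ → ℝ) (α : Dyadic → ℝ≥0), NonnegL1 f ∧ normL1 f = t ∧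
      carlesonConst α ≤ 1 ∧ m = distrib (lernerOp α f) lam}
      (ENNReal.ofReal (levelBound t lam)) := by
  refine ⟨?_, fun c hc => ?_⟩
  · rintro m ⟨f, α, hf, rfl, hα, rfl⟩
    exact distrib_lernerOp_le hf hα hlam
  have hle {v : ℝ} (h : Achievable t 1 lam v) : ENNReal.ofReal v ≤ c := by
    obtain ⟨f, α, hf, hn, hα, hv⟩ := h.exists_lernerOp
    exact hv.trans (hc ⟨f, α, hf, hn, hα, rfl⟩)
  unfold levelBound
  split_ifs with htl
  · rcases ht.eq_or_lt with rfl | ht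
    · simp
    have hcont : ContinuousAt (fun r : ℝ => r * ((1 + r) * t / (lam + r * t))) 1 :=
      continuousAt_id.mul (ContinuousAt.div (by fun_prop) (by fun_prop) (by linarith))
    have hlim := ENNReal.tendsto_ofReal (hcont.tendsto.comp tendsto_dilutionRatio)
    rw [one_mul, one_mul, one_add_one_eq_two] at hlim
    refine le_of_tendsto hlim ((Filter.eventually_ne_atTop 0).mono fun m hm => ?_)
    obtain ⟨v, hv, hA⟩ := exists_achievable_ge ht htl hm
    exact (ENNReal.ofReal_le_ofReal hv).trans (hle hA)
  · exact hle (achievable_one (by linarith) (by linarith))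

theorem two_le_of_weakL1_le {C : ℝ≥0∞}
    (hC : ∀ (f : ℝ → ℝ) (α : Dyadic → ℝ≥0), NonnegL1 f → carlesonConst α ≤ 1 →
      weakL1 (lernerOp α f) ≤ C * ENNReal.ofReal (normL1 f)) : 2 ≤ C := by
  have hbound {lam : ℝ} (hlam : 0 < lam) : ENNReal.ofReal (lam * levelBound 1 lam) ≤ C := by
    have hsup : ENNReal.ofReal (levelBound 1 lam) ≤ C / ENNReal.ofReal lam := by
      refine (isLUB_distrib_lernerOp zero_le_one hlam).2 ?_
      rintro m ⟨f, α, hf, hn, hα, rfl⟩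
      rw [ENNReal.le_div_iff_mul_le (by simp [hlam]) (by simp), mul_comm]
      have hweak : weakL1 (lernerOp α f) ≤ C := by
        simpa only [hn, ENNReal.ofReal_one, mul_one] using hC f α hf hα
      exact (le_iSup₂ (f := fun (lam : ℝ) (_ : 0 < lam) =>
        ENNReal.ofReal lam * distrib (lernerOp α f) lam) lam hlam).trans hweak
    rw [ENNReal.ofReal_mul hlam.le, mul_comm]
    exact ENNReal.mul_le_of_le_div hsup
  have hlim : Filter.Tendsto (fun n : ℕ => 2 * ((n : ℝ) / (n + 1))) Filter.atTop (nhds 2) := by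
    simpa using (tendsto_natCast_div_add_atTop (1 : ℝ)).const_mul 2
  rw [← ENNReal.ofReal_ofNat]
  refine le_of_tendsto (ENNReal.tendsto_ofReal hlim)
    ((Filter.eventually_ge_atTop 1).mono fun n hn => ?_)
  have hn' : (1 : ℝ) ≤ n := Nat.one_le_cast.2 hn
  refine le_of_eq_of_le ?_ (hbound (one_pos.trans_le hn'))
  rw [levelBound, if_pos hn']
  ring_nf

end DyadicShift

end

theorem mainTheorem2 :
    -- the bound on the superlevel sets
    (∀ (f : ℝ → ℝ) (α : DyadicShift.Dyadic → ℝ≥0),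
      DyadicShift.NonnegL1 f → DyadicShift.carlesonConst α ≤ 1 →
      ∀ lam : ℝ, 0 < lam →
        DyadicShift.distrib (DyadicShift.lernerOp α f) lam ≤
          ENNReal.ofReal (DyadicShift.levelBound (DyadicShift.normL1 f) lam)) ∧
    -- it is sharp for every value of the norm and every level
    (∀ t lam : ℝ, 0 ≤ t → 0 < lam →
      IsLUB
        {m : ℝ≥0∞ | ∃ (f : ℝ → ℝ) (α : DyadicShift.Dyadic → ℝ≥0),
          DyadicShift.NonnegL1 f ∧ DyadicShift.normL1 f = t ∧
          DyadicShift.carlesonConst α ≤ 1 ∧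
          m = DyadicShift.distrib (DyadicShift.lernerOp α f) lam}
        (ENNReal.ofReal (DyadicShift.levelBound t lam))) ∧
    -- the weak-type estimate
    (∀ (f : ℝ → ℝ) (α : DyadicShift.Dyadic → ℝ≥0),
      DyadicShift.NonnegL1 f → DyadicShift.carlesonConst α ≤ 1 →
      DyadicShift.weakL1 (DyadicShift.lernerOp α f) ≤
        2 * ENNReal.ofReal (DyadicShift.normL1 f)) ∧
    -- the constant 2 cannot be lowered
    (∀ C : ℝ≥0∞,
      (∀ (f : ℝ → ℝ) (α : DyadicShift.Dyadic → ℝ≥0),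
        DyadicShift.NonnegL1 f → DyadicShift.carlesonConst α ≤ 1 →
        DyadicShift.weakL1 (DyadicShift.lernerOp α f) ≤
          C * ENNReal.ofReal (DyadicShift.normL1 f)) →
      2 ≤ C) :=
  ⟨fun _ _ hf hα _ hlam => DyadicShift.distrib_lernerOp_le hf hα hlam,
    fun _ _ ht hlam => DyadicShift.isLUB_distrib_lernerOp ht hlam,
    fun _ _ hf hα => DyadicShift.weakL1_lernerOp_le hf hα,
    fun _ hC => DyadicShift.two_le_of_weakL1_le hC⟩
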